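/- For a linear subspace $\mathcal X\subset\mathbb R^m$ let $P_{\mathcal X}=UU^{\mathrm T}$ be its projection matrix, where the columns of $U$ form an orthonormal basis of $\mathcal X$, and let $$D(\mathcal X_1,\mathcal X_2)=\frac1{\sqrt2}\,\|P_{\mathcal X_1}-P_{\mathcal X_2}\|_F$$ be the generalized projection $F$-norm distance between two subspaces of $\mathbb R^m$ (of possibly different dimensions), where $\|\cdot\|_F$ is the Frobenius norm. Let $d_1\le d_2$ be non-negative integers and $\varepsilon>0$. Then there is $n_0$, depending only on $d_1,d_2,\varepsilon$, such that the following holds for all $n\ge n_0$, all $N$ and all subspaces $\mathcal X_1,\mathcal X_2\subset\mathbb R^N$ of dimensions $d_1$ and $d_2$. Let $\Phi\in\mathbb R^{n\times N}$ be a Gaussian random matrix, i.e. its entries are independent with distribution $\mathcal N(0,1/n)$, and let $\mathcal Y_k=\{\Phi x : x\in\mathcal X_k\}\subset\mathbb R^n$, $k=1,2$. Put $D_{\mathcal X}=D(\mathcal X_1,\mathcal X_2)$ and $D_{\mathcal Y}=D(\mathcal Y_1,\mathcal Y_2)$. Then $$(1-\varepsilon)D_{\mathcal X}^2\le D_{\mathcal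 Y}^2\le(1+\varepsilon)D_{\mathcal X}^2$$ with probability at least $$1-\frac{4d_1}{(\varepsilon-d_2/n)^2\,n}.$$ -/

import Mathlib

open MeasureTheory ProbabilityTheory
open scoped NNReal

noncomputable section

/-- The projection matrix `P` of a subspace `X` of `ℝᵐ`: the matrix, in the standard basis, of the
orthogonal projection onto `X`. -/
def projMatrix {m : ℕ} (X : Submodule ℝ (EuclideanSpace ℝ (Fin m))) :
    Matrix (Fin m) (Fin m) ℝ :=
  Matrix.of fun i j => X.starProjection (EuclideanSpace.single j (1 : ℝ)) i

/-- The projection matrix is `U Uᵀ`, where the columns of `U` are any orthonormal basis of `X`. -/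
theorem projMatrix_eq_mul_transpose {m : ℕ} {ι : Type*} [Fintype ι]
    (X : Submodule ℝ (EuclideanSpace ℝ (Fin m))) (b : OrthonormalBasis ι ℝ X) :
    projMatrix X =
      (Matrix.of fun (i : Fin m) (k : ι) => (b k : EuclideanSpace ℝ (Fin m)) i) *
        (Matrix.of fun (i : Fin m) (k : ι) => (b k : EuclideanSpace ℝ (Fin m)) i).transpose := by
  ext i j
  simp [projMatrix, Matrix.mul_apply, b.starProjection_eq_sum_rankOne,
    EuclideanSpace.inner_single_right, mul_comm]

section Frobenius

attribute [local instance] Matrix.frobeniusNormedAddCommGroup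

/-- The generalized projection `F`-norm distance `‖P₁ - P₂‖_F / √2` between two subspaces of `ℝᵐ`,
possibly of different dimensions; the norm here is the Frobenius norm. -/
def projFDist {m : ℕ} (X₁ X₂ : Submodule ℝ (EuclideanSpace ℝ (Fin m))) : ℝ :=
  1 / Real.sqrt 2 * ‖projMatrix X₁ - projMatrix X₂‖

end Frobenius

/-- The image `{Φ x | x ∈ X}` of a subspace `X` of `ℝᴺ` under a matrix `Φ`. -/
def projectSubspace {n N : ℕ} (Φ : Matrix (Fin n) (Fin N) ℝ)
    (X : Submodule ℝ (EuclideanSpace ℝ (Fin N))) : Submodule ℝ (EuclideanSpace ℝ (Fin n)) :=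
  X.map (Matrix.toEuclideanLin Φ)

/-- `Φ` is an `n × N` Gaussian random matrix: its entries are independent with the
distribution `𝒩(0, 1/n)`. -/
structure IsGaussianRandomMatrix {n N : ℕ} {Ω : Type*} [MeasurableSpace Ω]
    (Φ : Ω → Matrix (Fin n) (Fin N) ℝ) (P : Measure Ω) : Prop where
  hasLaw_entry : ∀ i j, HasLaw (fun ω => Φ ω i j) (gaussianReal 0 ((n : ℝ≥0)⁻¹)) P
  indep_entries : iIndepFun (fun (p : Fin n × Fin N) ω => Φ ω p.1 p.2) P

end

/-! Expanding the Frobenius norm and using cyclicity of the trace gives `D(X, Y)² = (dim Y - dim X)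
/ 2 + ‖(1 - P_Y) P_X‖²`, with the Hilbert-Schmidt norm on the right (`projFDist_sq`). The last term
sums squared distances to `Y` over an orthonormal basis of `X`. A linear map with bounds `a‖w‖² ≤ ‖T
w‖² ≤ b‖w‖²` on `X + Y` therefore changes it by a factor between `a / b` and `b / a`
(`projDefect_map_bounds`), and keeps both dimensions.

It remains to make `Φ` a near-isometry of `X₁ + X₂`. A Chernoff bound for `‖Φ u‖²` at finitely many
vectors, followed by polarization, shows that this fails with probability at most `C ρ ^ n`, where
`C` and `ρ < 1` depend only on `d₁, d₂, ε`. For `d₁ ≥ 1` and large `n` this is below the allowed `4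
d₁ / ((ε - d₂ / n)² n)`. For `d₁ = 0` the claim is an almost sure one: both squared distances equal
`d₂ / 2` as soon as `Φ` is injective on `X₂`. -/

/-! ### Hilbert-Schmidt sums. -/

section HilbertSchmidt

variable {E E' F : Type*} [NormedAddCommGroup E] [InnerProductSpace ℝ E] [FiniteDimensional ℝ E]
  [NormedAddCommGroup E'] [InnerProductSpace ℝ E'] [FiniteDimensional ℝ E']
  [NormedAddCommGroup F] [InnerProductSpace ℝ F] [FiniteDimensional ℝ F]
  {ι ι' κ : Type*} [Fintype ι] [Fintype ι'] [Fintype κ]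

/-- By Parseval both sides are the sum of the squared matrix entries of `A`; in particular the left
side does not depend on `b`. -/
theorem sum_norm_sq_apply_eq_sum_norm_sq_adjoint (A : E →ₗ[ℝ] F)
    (b : OrthonormalBasis ι ℝ E) (c : OrthonormalBasis κ ℝ F) :
    ∑ i, ‖A (b i)‖ ^ 2 = ∑ k, ‖LinearMap.adjoint A (c k)‖ ^ 2 := by
  have h1 : ∀ i, ‖A (b i)‖ ^ 2 = ∑ k, (inner ℝ (c k) (A (b i))) ^ 2 := fun i =>
    (c.sum_sq_inner_right _).symm
  have h2 : ∀ k, ‖LinearMap.adjoint A (c k)‖ ^ 2 = ∑ i, (inner ℝ (c k) (A (b i))) ^ 2 := fun k => by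
    rw [← b.sum_sq_inner_left]
    simp [LinearMap.adjoint_inner_left]
  simp_rw [h1, h2]
  exact Finset.sum_comm

theorem norm_adjoint_apply_sq_le (R : E' →ₗ[ℝ] E) {c : ℝ} (hc : 0 ≤ c) (hR : ∀ x, ‖R x‖ ^ 2 ≤ c * ‖x‖ ^ 2)
    (z : E) : ‖LinearMap.adjoint R z‖ ^ 2 ≤ c * ‖z‖ ^ 2 := by
  set w := LinearMap.adjoint R z with hw
  have h1 : ‖w‖ ^ 2 ≤ ‖R w‖ * ‖z‖ := by
    rw [← real_inner_self_eq_norm_sq]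
    conv_lhs => rw [hw, LinearMap.adjoint_inner_left, ← hw, real_inner_comm]
    exact real_inner_le_norm _ _
  have h2 := hR w
  rcases eq_or_ne ‖w‖ 0 with h0 | h0
  · rw [h0]; simp only [ne_eq, OfNat.ofNat_ne_zero, not_false_eq_true, zero_pow]; positivity
  · have : (‖w‖ ^ 2) ^ 2 ≤ (c * ‖w‖ ^ 2) * ‖z‖ ^ 2 := by
      calc (‖w‖ ^ 2) ^ 2 ≤ (‖R w‖ * ‖z‖) ^ 2 := by gcongr
        _ = ‖R w‖ ^ 2 * ‖z‖ ^ 2 := by ring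
        _ ≤ _ := by gcongr
    have hpos : 0 < ‖w‖ ^ 2 := by positivity
    nlinarith

/-- The ideal property of the Hilbert-Schmidt norm. After passing to adjoints `R` acts last, so its
norm bound applies term by term. -/
theorem sum_norm_sq_comp_le (A : E →ₗ[ℝ] F) (R : E' →ₗ[ℝ] E) {c : ℝ} (hc : 0 ≤ c)
    (hR : ∀ x, ‖R x‖ ^ 2 ≤ c * ‖x‖ ^ 2) (b : OrthonormalBasis ι ℝ E)
    (b' : OrthonormalBasis ι' ℝ E') :
    ∑ j, ‖A (R (b' j))‖ ^ 2 ≤ c * ∑ i, ‖A (b i)‖ ^ 2 := by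
  let f := stdOrthonormalBasis ℝ F
  have h := sum_norm_sq_apply_eq_sum_norm_sq_adjoint (A ∘ₗ R) b' f
  simp only [LinearMap.comp_apply, LinearMap.adjoint_comp] at h
  rw [h, sum_norm_sq_apply_eq_sum_norm_sq_adjoint A b f, Finset.mul_sum]
  exact Finset.sum_le_sum fun k _ => norm_adjoint_apply_sq_le R hc hR _

/-- For a subspace `X` with orthonormal basis `c`, the squared Hilbert-Schmidt norm of `A P_X` is
the sum of the `‖A (c k)‖²`. -/
theorem sum_norm_sq_apply_starProjection (A : E →ₗ[ℝ] F) (X : Submodule ℝ E)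
    (b : OrthonormalBasis ι ℝ E) (c : OrthonormalBasis κ ℝ X) :
    ∑ i, ‖A (X.starProjection (b i))‖ ^ 2 = ∑ k, ‖A (c k)‖ ^ 2 := by
  let f := stdOrthonormalBasis ℝ F
  have h1 := sum_norm_sq_apply_eq_sum_norm_sq_adjoint (A ∘ₗ (X.starProjection : E →ₗ[ℝ] E)) b f
  have h2 := sum_norm_sq_apply_eq_sum_norm_sq_adjoint (A ∘ₗ X.subtype) c f
  simp only [LinearMap.comp_apply, Submodule.subtype_apply, ContinuousLinearMap.coe_coe] at h1 h2
  rw [h1, h2]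
  refine Finset.sum_congr rfl fun k _ => ?_
  have key : ((LinearMap.adjoint (A ∘ₗ X.subtype) (f k) : X) : E) =
      LinearMap.adjoint (A ∘ₗ (X.starProjection : E →ₗ[ℝ] E)) (f k) := by
    refine ext_inner_right ℝ fun v => ?_
    rw [LinearMap.adjoint_inner_left, ← X.starProjection_mem_subspace_eq_self,
      X.inner_starProjection_left_eq_right]
    exact LinearMap.adjoint_inner_left (A ∘ₗ X.subtype) (X.orthogonalProjectionOnto v) (f k)
  rw [← key, Submodule.coe_norm]

end HilbertSchmidt

/-! ### The defect and its distortion under linear maps. -/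

section ProjDefect

variable {E F : Type*} [NormedAddCommGroup E] [InnerProductSpace ℝ E] [FiniteDimensional ℝ E]
  [NormedAddCommGroup F] [InnerProductSpace ℝ F] [FiniteDimensional ℝ F]

/-- The squared Hilbert-Schmidt norm of `(1 - P_Y) P_X`, that is, the sum of the squared distances
to `Y` of the vectors of an orthonormal basis of `X`. -/
noncomputable def projDefect (X Y : Submodule ℝ E) : ℝ :=
  ∑ i, ‖((stdOrthonormalBasis ℝ X i : X) : E) - Y.starProjection (stdOrthonormalBasis ℝ X i : X)‖ ^ 2

theorem projDefect_nonneg (X Y : Submodule ℝ E) : 0 ≤ projDefect X Y :=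
  Finset.sum_nonneg fun _ _ => by positivity

/-- `C` compares distances at corresponding vectors; `c` pays for `R` not sending an orthonormal
basis to an orthonormal one. -/
theorem projDefect_le {X Y : Submodule ℝ E} {X' Y' : Submodule ℝ F} {c C : ℝ} (hc : 0 ≤ c)
    (hC : 0 ≤ C) (R : X' →ₗ[ℝ] X) (hR : ∀ x, ‖R x‖ ^ 2 ≤ c * ‖x‖ ^ 2)
    (hd : ∀ x : X', ‖(x : F) - Y'.starProjection x‖ ^ 2 ≤
      C * ‖(R x : E) - Y.starProjection (R x)‖ ^ 2) :
    projDefect X' Y' ≤ C * c * projDefect X Y := by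
  have h := sum_norm_sq_comp_le ((LinearMap.id - (Y.starProjection : E →ₗ[ℝ] E)) ∘ₗ X.subtype) R hc
    hR (stdOrthonormalBasis ℝ X) (stdOrthonormalBasis ℝ X')
  simp only [LinearMap.comp_apply, Submodule.subtype_apply, LinearMap.sub_apply, LinearMap.id_apply,
    ContinuousLinearMap.coe_coe] at h
  calc projDefect X' Y' ≤ ∑ j, C * _ := Finset.sum_le_sum fun j _ => hd _
    _ ≤ C * (c * projDefect X Y) := by
      rw [← Finset.mul_sum]
      exact mul_le_mul_of_nonneg_left h hC
    _ = _ := by ring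

theorem norm_sub_starProjection_le (Y : Submodule ℝ E) (x : E) {y : E} (hy : y ∈ Y) :
    ‖x - Y.starProjection x‖ ≤ ‖x - y‖ := by
  rw [Submodule.starProjection_minimal]
  exact ciInf_le ⟨0, by rintro _ ⟨z, rfl⟩; positivity⟩ (⟨y, hy⟩ : Y)

omit [FiniteDimensional ℝ E] [FiniteDimensional ℝ F] in
theorem injOn_of_lower_bound {T : E →ₗ[ℝ] F} {W : Submodule ℝ E} {a : ℝ} (ha : 0 < a)
    (h : ∀ w ∈ W, a * ‖w‖ ^ 2 ≤ ‖T w‖ ^ 2) : ∀ w ∈ W, T w = 0 → w = 0 := by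
  intro w hw h0
  have h1 := h w hw
  rw [h0, norm_zero] at h1
  have : ‖w‖ ^ 2 ≤ 0 := by
    by_contra! hc
    nlinarith [mul_pos ha hc]
  simpa using pow_eq_zero_iff (two_ne_zero) |>.1 (le_antisymm this (sq_nonneg _))

omit [FiniteDimensional ℝ E] [FiniteDimensional ℝ F] in
theorem finrank_map_of_injOn {T : E →ₗ[ℝ] F} {X : Submodule ℝ E}
    (h : ∀ w ∈ X, T w = 0 → w = 0) : Module.finrank ℝ (X.map T) = Module.finrank ℝ X := by
  have hinj : Function.Injective (T.submoduleMap X) := by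
    rw [injective_iff_map_eq_zero]
    intro x hx
    exact Subtype.ext (h x x.2 (congrArg Subtype.val hx))
  exact (LinearEquiv.ofBijective _ ⟨hinj, T.submoduleMap_surjective X⟩).finrank_eq.symm

/-- A linear map that is bounded above and below on `X + Y` distorts `projDefect X Y` by at most
the quotient of the bounds. -/
theorem projDefect_map_bounds {T : E →ₗ[ℝ] F} {X Y : Submodule ℝ E} {a b : ℝ} (ha : 0 < a)
    (hb : 0 ≤ b) (hl : ∀ w ∈ X ⊔ Y, a * ‖w‖ ^ 2 ≤ ‖T w‖ ^ 2)
    (hu : ∀ w ∈ X ⊔ Y, ‖T w‖ ^ 2 ≤ b * ‖w‖ ^ 2) :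
    projDefect (X.map T) (Y.map T) ≤ b * a⁻¹ * projDefect X Y ∧
      projDefect X Y ≤ a⁻¹ * b * projDefect (X.map T) (Y.map T) := by
  have hX : X ≤ X ⊔ Y := le_sup_left
  have hY : Y ≤ X ⊔ Y := le_sup_right
  have hinj : Function.Injective (T.submoduleMap X) := by
    rw [injective_iff_map_eq_zero]
    intro x hx
    exact Subtype.ext (injOn_of_lower_bound ha hl x (hX x.2) (congrArg Subtype.val hx))
  let S := LinearEquiv.ofBijective _ ⟨hinj, T.submoduleMap_surjective X⟩
  have hS : ∀ x : X, ((S x : X.map T) : F) = T x := fun x => rfl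
  have hl' : ∀ w ∈ X ⊔ Y, ‖w‖ ^ 2 ≤ a⁻¹ * ‖T w‖ ^ 2 := fun w hw => by
    rw [inv_mul_eq_div, le_div_iff₀ ha, mul_comm]
    exact hl w hw
  constructor
  · refine projDefect_le (inv_nonneg.2 ha.le) hb S.symm.toLinearMap (fun x => ?_) (fun x => ?_)
    · obtain ⟨x, rfl⟩ := S.surjective x
      simpa [hS] using hl' x (hX x.2)
    · obtain ⟨x, rfl⟩ := S.surjective x
      -- The image of the point of `Y` nearest to `x` competes for the distance from `T x` to `T Y`.
      have hp := Y.starProjection_apply_mem (x : E)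
      have h1 := norm_sub_starProjection_le (Y.map T) (T x) (Submodule.mem_map_of_mem hp)
      rw [← map_sub] at h1
      have h2 := hu _ (Submodule.sub_mem _ (hX x.2) (hY hp))
      simp only [hS, LinearEquiv.coe_coe, LinearEquiv.symm_apply_apply]
      refine le_trans ?_ h2
      gcongr
  · refine projDefect_le hb (inv_nonneg.2 ha.le) S.toLinearMap (fun x => ?_) (fun x => ?_)
    · simpa [hS] using hu x (hX x.2)
    · simp only [LinearEquiv.coe_coe, hS]
      -- Conversely, a preimage in `Y` of the point of `T Y` nearest to `T x` competes for the
      -- distance from `x` to `Y`.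
      obtain ⟨y, hy, hyT⟩ := (Y.map T).starProjection_apply_mem (T x)
      have h1 := norm_sub_starProjection_le Y (x : E) hy
      rw [← hyT, ← map_sub]
      refine le_trans ?_ (hl' _ (Submodule.sub_mem _ (hX x.2) (hY hy)))
      gcongr

end ProjDefect

/-- The cross term is `tr(P_X P_Y) = tr(P_X P_Y P_X) = ‖P_Y P_X‖²`, which by Pythagoras is `dim X`
minus the defect. -/
theorem norm_sub_starProjections_sq {E : Type*} [NormedAddCommGroup E] [InnerProductSpace ℝ E]
    [FiniteDimensional ℝ E] {ι : Type*} [Fintype ι] (b : OrthonormalBasis ι ℝ E)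
    (X Y : Submodule ℝ E) :
    ∑ i, ‖X.starProjection (b i) - Y.starProjection (b i)‖ ^ 2 =
      Module.finrank ℝ Y - Module.finrank ℝ X + 2 * projDefect X Y := by
  have hX : ∑ i, ‖X.starProjection (b i)‖ ^ 2 = Module.finrank ℝ X := by
    simpa [← Submodule.coe_norm] using
      sum_norm_sq_apply_starProjection LinearMap.id X b (stdOrthonormalBasis ℝ X)
  have hY : ∑ i, ‖Y.starProjection (b i)‖ ^ 2 = Module.finrank ℝ Y := by
    simpa [← Submodule.coe_norm] using
      sum_norm_sq_apply_starProjection LinearMap.id Y b (stdOrthonormalBasis ℝ Y)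
  have hD : ∑ i, ‖X.starProjection (b i) - Y.starProjection (X.starProjection (b i))‖ ^ 2 =
      projDefect X Y := by
    exact sum_norm_sq_apply_starProjection
      (LinearMap.id - (Y.starProjection : E →ₗ[ℝ] E)) X b (stdOrthonormalBasis ℝ X)
  have hcross : ∑ i, inner ℝ (X.starProjection (b i)) (Y.starProjection (b i)) =
      ∑ i, ‖Y.starProjection (X.starProjection (b i))‖ ^ 2 := by
    have h1 := LinearMap.trace_eq_sum_inner
      ((X.starProjection : E →ₗ[ℝ] E) * (Y.starProjection : E →ₗ[ℝ] E)) b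
    have h2 := LinearMap.trace_eq_sum_inner ((X.starProjection : E →ₗ[ℝ] E) *
      ((Y.starProjection : E →ₗ[ℝ] E) * (X.starProjection : E →ₗ[ℝ] E))) b
    have h3 : (X.starProjection : E →ₗ[ℝ] E) * (X.starProjection : E →ₗ[ℝ] E) =
        (X.starProjection : E →ₗ[ℝ] E) :=
      LinearMap.ext fun v => X.starProjection_eq_self_iff.2 (X.starProjection_apply_mem v)
    rw [← mul_assoc, LinearMap.trace_mul_comm, ← mul_assoc, h3, h1] at h2
    simp only [Module.End.mul_apply, ContinuousLinearMap.coe_coe,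
      ← X.inner_starProjection_left_eq_right] at h2
    rw [h2]
    refine Finset.sum_congr rfl fun i _ => ?_
    rw [← real_inner_self_eq_norm_sq, Y.inner_starProjection_left_eq_right,
      Y.starProjection_eq_self_iff.2 (Y.starProjection_apply_mem _)]
  have hpyth : ∀ v : E, ‖v‖ ^ 2 = ‖Y.starProjection v‖ ^ 2 + ‖v - Y.starProjection v‖ ^ 2 := by
    intro v
    rw [Submodule.norm_sq_eq_add_norm_sq_starProjection v Y, Submodule.starProjection_orthogonal_val]
  have hsum : ∑ i, ‖X.starProjection (b i)‖ ^ 2 =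
      ∑ i, ‖Y.starProjection (X.starProjection (b i))‖ ^ 2 + projDefect X Y := by
    rw [← hD, ← Finset.sum_add_distrib]
    exact Finset.sum_congr rfl fun i _ => hpyth _
  simp_rw [norm_sub_sq_real, Finset.sum_add_distrib, Finset.sum_sub_distrib, ← Finset.mul_sum]
  linarith

theorem projFDist_sq {m : ℕ} (X Y : Submodule ℝ (EuclideanSpace ℝ (Fin m))) :
    projFDist X Y ^ 2 =
      ((Module.finrank ℝ Y : ℝ) - Module.finrank ℝ X) / 2 + projDefect X Y := by
  have h := norm_sub_starProjections_sq (EuclideanSpace.basisFun (Fin m) ℝ) X Y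
  rw [projFDist, Matrix.frobenius_norm_def, mul_pow, div_pow, Real.sq_sqrt (by norm_num), ← Real.sqrt_eq_rpow,
    Real.sq_sqrt (by positivity), Finset.sum_comm]
  have h2 : ∑ j, ∑ i, ‖(projMatrix X - projMatrix Y) i j‖ ^ (2 : ℝ) = ∑ j,
      ‖X.starProjection (EuclideanSpace.basisFun (Fin m) ℝ j) -
        Y.starProjection (EuclideanSpace.basisFun (Fin m) ℝ j)‖ ^ 2 := by
    refine Finset.sum_congr rfl fun j _ => ?_
    rw [EuclideanSpace.norm_sq_eq]
    simp [projMatrix]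
  rw [h2, h]
  ring

/-! ### Almost sure injectivity. -/

section AbsolutelyContinuous

theorem pi_absolutelyContinuous_fin {n : ℕ} {E : Fin n → Type*} [∀ i, MeasurableSpace (E i)]
    {μ ν : (i : Fin n) → Measure (E i)} [∀ i, SigmaFinite (μ i)] [∀ i, SigmaFinite (ν i)]
    (h : ∀ i, μ i ≪ ν i) : Measure.pi μ ≪ Measure.pi ν := by
  induction n with
  | zero => rw [Measure.pi_of_empty, Measure.pi_of_empty]
  | succ n ih =>
    have h1 := (measurePreserving_piFinSuccAbove μ 0).symm.map_eq
    have h2 := (measurePreserving_piFinSuccAbove ν 0).symm.map_eq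
    rw [← h1, ← h2]
    exact ((h 0).prod (ih fun i => h _)).map (MeasurableEquiv.measurable _)

theorem pi_absolutelyContinuous {ι : Type*} [Fintype ι] {E : ι → Type*}
    [∀ i, MeasurableSpace (E i)] {μ ν : (i : ι) → Measure (E i)} [∀ i, SigmaFinite (μ i)]
    [∀ i, SigmaFinite (ν i)] (h : ∀ i, μ i ≪ ν i) : Measure.pi μ ≪ Measure.pi ν := by
  let e := (Fintype.equivFin ι).symm
  rw [← (measurePreserving_piCongrLeft μ e).map_eq, ← (measurePreserving_piCongrLeft ν e).map_eq]
  exact (pi_absolutelyContinuous_fin fun i => h _).map (MeasurableEquiv.measurable _)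

end AbsolutelyContinuous

/-- The zero set of a continuous function is null if every line in a fixed direction meets it in a
null set. -/
theorem volume_zeroSet_eq_zero_of_lines {ι : Type*} [Fintype ι] {g : (ι → ℝ) → ℝ}
    (hg : Continuous g) (v : ι → ℝ) (h : ∀ x, volume {t : ℝ | g (x + t • v) = 0} = 0) :
    volume {x | g x = 0} = 0 := by
  let s : Set ((ι → ℝ) × ℝ) := {p | g (p.1 + p.2 • v) = 0}
  have hs : MeasurableSet s := (isClosed_eq (by fun_prop) continuous_const).measurableSet
  have h1 : (volume.prod volume) s = 0 :=
    Measure.measure_prod_null_of_ae_null hs (Filter.Eventually.of_forall h)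
  -- Fubini in the other order: for some `t` the slice at `t` is null, and it is a translate of the
  -- zero set.
  have h2 : (volume.prod volume) (Prod.swap ⁻¹' s) = 0 := by
    rw [Measure.measurePreserving_swap.measure_preimage hs.nullMeasurableSet, h1]
  obtain ⟨t, ht⟩ := (Measure.measure_ae_null_of_prod_null h2).exists
  rw [← measure_preimage_add_right volume (t • v)]
  exact ht

/-- The determinant is the characteristic polynomial of `-A` at `t`. -/
theorem finite_setOf_det_add_smul_one_eq_zero {d : ℕ} (A : Matrix (Fin d) (Fin d) ℝ) :
    {t : ℝ | (A + t • (1 : Matrix (Fin d) (Fin d) ℝ)).det = 0}.Finite := by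
  refine (Polynomial.finite_setOfPred_isRoot (-A).charpoly_monic.ne_zero).subset fun t ht => ?_
  rw [Set.mem_ofPred_eq, Polynomial.IsRoot, Matrix.eval_charpoly, ← ht.out, Matrix.smul_one_eq_diagonal,
    ← Matrix.scalar_apply, sub_neg_eq_add, add_comm]

/-- A Gaussian random matrix with at least `dim X` rows is almost surely injective on `X`. -/
theorem IsGaussianRandomMatrix.ae_injOn {n N : ℕ} {Ω : Type*} [MeasurableSpace Ω]
    {P : Measure Ω} {Φ : Ω → Matrix (Fin n) (Fin N) ℝ} (hΦ : IsGaussianRandomMatrix Φ P)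
    (X : Submodule ℝ (EuclideanSpace ℝ (Fin N))) (hn : Module.finrank ℝ X ≤ n) (hn0 : n ≠ 0) :
    ∀ᵐ ω ∂P, ∀ w ∈ X, Matrix.toEuclideanLin (Φ ω) w = 0 → w = 0 := by
  let d := Module.finrank ℝ X
  let b := stdOrthonormalBasis ℝ X
  let B : Matrix (Fin N) (Fin d) ℝ := Matrix.of fun i k => (b k : EuclideanSpace ℝ (Fin N)) i
  have hB : B.transpose * B = 1 := by
    ext k l
    have h := b.inner_eq_ite k l
    rw [Submodule.coe_inner, PiLp.inner_apply] at h
    simpa [B, Matrix.mul_apply, Matrix.one_apply, mul_comm] using h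
  -- The minor on the first `d` rows of the matrix restricted to `X`; if it is nonzero, the matrix
  -- is injective on `X`.
  let g : (Fin n × Fin N → ℝ) → ℝ := fun x =>
    (((Matrix.of fun i j => x (i, j)) * B).submatrix (Fin.castLE hn) id).det
  have hg : Continuous g := by
    refine Continuous.matrix_det ?_
    refine Continuous.matrix_submatrix ?_ _ _
    exact Continuous.matrix_mul (by fun_prop) continuous_const
  -- Moving in the direction `M₀` adds a multiple of the identity to the block defining `g`.
  let M₀ : Matrix (Fin n) (Fin N) ℝ :=
    (Matrix.of fun i k => if i = Fin.castLE hn k then (1 : ℝ) else 0 : Matrix (Fin n) (Fin d) ℝ) * B.transpose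
  have hM₀ : (M₀ * B).submatrix (Fin.castLE hn) id = 1 := by
    rw [Matrix.mul_assoc, hB, Matrix.mul_one]
    ext k l
    simp [Matrix.one_apply]
  have hnull : volume {x | g x = 0} = 0 := by
    refine volume_zeroSet_eq_zero_of_lines hg (fun p => M₀ p.1 p.2) fun x => ?_
    refine Set.Finite.measure_zero ?_ _
    have hx : ∀ t : ℝ, g (x + t • fun p => M₀ p.1 p.2) =
        (((Matrix.of fun i j => x (i, j)) * B).submatrix (Fin.castLE hn) id +
          t • (1 : Matrix (Fin d) (Fin d) ℝ)).det := fun t => by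
      rw [← hM₀]
      have : (Matrix.of fun i j => (x + t • fun p : Fin n × Fin N => M₀ p.1 p.2) (i, j)) =
        (Matrix.of fun i j => x (i, j)) + t • M₀ := rfl
      simp only [g]
      rw [this, Matrix.add_mul, Matrix.smul_mul]
      rfl
    simp_rw [hx]
    exact finite_setOf_det_add_smul_one_eq_zero _
  have hlaw := iIndepFun.hasLaw_pi (fun p : Fin n × Fin N => hΦ.hasLaw_entry p.1 p.2)
    hΦ.indep_entries
  have hac : Measure.pi (fun _ : Fin n × Fin N => gaussianReal 0 ((n : ℝ≥0)⁻¹)) ≪ volume :=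
    pi_absolutelyContinuous fun _ => gaussianReal_absolutelyContinuous 0 (by simpa using hn0)
  have hae : ∀ᵐ x ∂(P.map fun ω (p : Fin n × Fin N) => Φ ω p.1 p.2), g x ≠ 0 := by
    rw [hlaw.map_eq]
    have hg0 : ∀ᵐ x, g x ≠ 0 := by rw [ae_iff]; simpa using hnull
    exact hac.ae_le hg0
  filter_upwards [ae_of_ae_map hlaw.aemeasurable hae] with ω hω w hw h0
  by_contra hw0
  refine hω (Matrix.exists_mulVec_eq_zero_iff.1 ⟨fun k => b.repr ⟨w, hw⟩ k, ?_, ?_⟩)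
  · intro hc
    apply hw0
    have : b.repr ⟨w, hw⟩ = 0 := by
      ext k
      exact congrFun hc k
    simpa using this
  · have hBc : B.mulVec (fun k => b.repr ⟨w, hw⟩ k) = w := by
      ext i
      have := congrArg (fun x : X => (x : EuclideanSpace ℝ (Fin N)) i) (b.sum_repr ⟨w, hw⟩)
      simp only [Matrix.mulVec, dotProduct]
      simpa [B, mul_comm] using this
    ext k
    have h3 : ((Matrix.of fun i j => Φ ω i j) * B).mulVec (fun k => b.repr ⟨w, hw⟩ k) = 0 := by
      rw [← Matrix.mulVec_mulVec, hBc]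
      exact congrArg WithLp.ofLp h0
    exact congrFun h3 (Fin.castLE hn k)

/-! ### Moment generating function of a squared Gaussian. -/

section GaussianSquare

theorem gaussianPDFReal_mul_exp_sq {v : ℝ≥0} (t x : ℝ) :
    gaussianPDFReal 0 v x * Real.exp (t * x ^ 2) =
      (√(2 * Real.pi * v))⁻¹ * Real.exp (-((2 * (v : ℝ))⁻¹ - t) * x ^ 2) := by
  rw [gaussianPDFReal, mul_assoc, ← Real.exp_add]
  congr 2
  ring

theorem integrable_exp_mul_sq_gaussianReal {v : ℝ≥0} (hv : v ≠ 0) {t : ℝ}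
    (ht : t < (2 * (v : ℝ))⁻¹) :
    Integrable (fun x : ℝ => Real.exp (t * x ^ 2)) (gaussianReal 0 v) := by
  rw [gaussianReal_of_var_ne_zero _ hv, integrable_withDensity_iff_integrable_smul'
    (measurable_gaussianPDF _ _) (Filter.Eventually.of_forall fun _ => gaussianPDF_lt_top)]
  simp only [toReal_gaussianPDF, smul_eq_mul, gaussianPDFReal_mul_exp_sq]
  exact (integrable_exp_neg_mul_sq (sub_pos.2 ht)).const_mul _

theorem integral_exp_mul_sq_gaussianReal {v : ℝ≥0} (hv : v ≠ 0) {t : ℝ}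
    (ht : t < (2 * (v : ℝ))⁻¹) :
    ∫ x, Real.exp (t * x ^ 2) ∂(gaussianReal 0 v) = (√(1 - 2 * t * v))⁻¹ := by
  have hv' : (0 : ℝ) < v := by positivity
  have hpos : 0 < (2 * (v : ℝ))⁻¹ - t := sub_pos.2 ht
  rw [integral_gaussianReal_eq_integral_smul hv]
  simp only [smul_eq_mul, gaussianPDFReal_mul_exp_sq]
  rw [integral_const_mul, integral_gaussian, ← Real.sqrt_inv, ← Real.sqrt_inv,
    ← Real.sqrt_mul (by positivity)]
  congr 1
  have h2 : 1 - 2 * t * v = 2 * v * ((2 * (v : ℝ))⁻¹ - t) := by field_simp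
  rw [h2]
  have := Real.pi_pos.ne'
  have := hpos.ne'
  generalize (2 * (v : ℝ))⁻¹ - t = r at *
  field_simp

end GaussianSquare

/-! ### The coordinates of `Φ u`. -/

section RowVariables

variable {n N : ℕ} {Ω : Type*} [MeasurableSpace Ω] {P : Measure Ω} [IsProbabilityMeasure P]
  {Φ : Ω → Matrix (Fin n) (Fin N) ℝ}

omit [IsProbabilityMeasure P] in
theorem IsGaussianRandomMatrix.covariance_entries (hΦ : IsGaussianRandomMatrix Φ P)
    (p q : Fin n × Fin N) :
    cov[fun ω => Φ ω p.1 p.2, fun ω => Φ ω q.1 q.2; P] = if p = q then (n : ℝ)⁻¹ else 0 := by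
  have hL := fun p : Fin n × Fin N => hΦ.hasLaw_entry p.1 p.2
  have hg : ∀ p : Fin n × Fin N, HasGaussianLaw (fun ω => Φ ω p.1 p.2) P := fun p =>
    (hL p).hasGaussianLaw
  split_ifs with h
  · subst h
    rw [covariance_self (hL p).aemeasurable, (hL p).variance_eq, variance_id_gaussianReal]
    simp
  · exact (hΦ.indep_entries.indepFun h).covariance_eq_zero (hg p).memLp_two (hg q).memLp_two

theorem IsGaussianRandomMatrix.covariance_rows (hΦ : IsGaussianRandomMatrix Φ P)
    (u : EuclideanSpace ℝ (Fin N)) (i k : Fin n) :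
    cov[fun ω => ∑ j, Φ ω i j * u j, fun ω => ∑ j, Φ ω k j * u j; P] =
      if i = k then ‖u‖ ^ 2 * (n : ℝ)⁻¹ else 0 := by
  have hm : ∀ i j, MemLp (fun ω => Φ ω i j * u j) 2 P := fun i j =>
    (hΦ.hasLaw_entry i j).hasGaussianLaw.memLp_two.mul_const _
  rw [covariance_fun_sum_fun_sum (hm i) (hm k)]
  simp_rw [covariance_mul_const_left, covariance_mul_const_right,
    hΦ.covariance_entries (_, _) (_, _), Prod.mk.injEq]
  split_ifs with h
  · simp [h, EuclideanSpace.norm_sq_eq, Finset.sum_mul]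
    refine Finset.sum_congr rfl fun j _ => by ring
  · simp [h]

omit [IsProbabilityMeasure P] in
theorem IsGaussianRandomMatrix.hasGaussianLaw_rows (hΦ : IsGaussianRandomMatrix Φ P)
    (u : EuclideanSpace ℝ (Fin N)) :
    HasGaussianLaw (fun ω i => ∑ j, Φ ω i j * u j) P := by
  have h := iIndepFun.hasGaussianLaw (X := fun (p : Fin n × Fin N) ω => Φ ω p.1 p.2)
    (fun p => (hΦ.hasLaw_entry p.1 p.2).hasGaussianLaw) hΦ.indep_entries
  let A : (Fin n × Fin N → ℝ) →L[ℝ] (Fin n → ℝ) :=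
    ContinuousLinearMap.pi fun i => ∑ j, u j • ContinuousLinearMap.proj (i, j)
  have h2 := h.map_fun A
  simpa [A, mul_comm, ContinuousLinearMap.pi_apply] using h2

/-- The coordinates are jointly Gaussian, so being uncorrelated suffices. -/
theorem IsGaussianRandomMatrix.iIndepFun_rows (hΦ : IsGaussianRandomMatrix Φ P)
    (u : EuclideanSpace ℝ (Fin N)) :
    iIndepFun (fun i ω => ∑ j, Φ ω i j * u j) P :=
  (hΦ.hasGaussianLaw_rows u).iIndepFun_of_covariance_eq_zero fun i k hik => by
    rw [hΦ.covariance_rows u, if_neg hik]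

theorem IsGaussianRandomMatrix.hasLaw_rows (hΦ : IsGaussianRandomMatrix Φ P)
    {u : EuclideanSpace ℝ (Fin N)} (hu : ‖u‖ = 1) (i : Fin n) :
    HasLaw (fun ω => ∑ j, Φ ω i j * u j) (gaussianReal 0 ((n : ℝ≥0)⁻¹)) P := by
  have hg := (hΦ.hasGaussianLaw_rows u).eval i
  refine ⟨hg.aemeasurable, ?_⟩
  rw [hg.map_eq_gaussianReal, ← covariance_self hg.aemeasurable, hΦ.covariance_rows u i i, if_pos rfl,
    hu, integral_finsetSum _ fun j _ => ((hΦ.hasLaw_entry i j).hasGaussianLaw.integrable).mul_const _]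
  congr 1
  · refine Finset.sum_eq_zero fun j _ => ?_
    rw [integral_mul_const, (hΦ.hasLaw_entry i j).integral_eq, integral_id_gaussianReal, zero_mul]
  · ext
    simp

/-- `n ‖Φ u‖²` is chi-squared with `n` degrees of freedom, hence the parameter `s * n`. -/
theorem IsGaussianRandomMatrix.mgf_norm_sq (hΦ : IsGaussianRandomMatrix Φ P) (hn : n ≠ 0)
    {u : EuclideanSpace ℝ (Fin N)} (hu : ‖u‖ = 1) {s : ℝ} (hs : s < 1 / 2) :
    Integrable (fun ω => Real.exp (s * n * ‖Matrix.toEuclideanLin (Φ ω) u‖ ^ 2)) P ∧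
      mgf (fun ω => ‖Matrix.toEuclideanLin (Φ ω) u‖ ^ 2) P (s * n) = (√(1 - 2 * s))⁻¹ ^ n := by
  have hn' : (0 : ℝ) < n := by positivity
  have hv : ((n : ℝ≥0)⁻¹) ≠ 0 := by positivity
  have ht : s * n < (2 * (((n : ℝ≥0)⁻¹ : ℝ≥0) : ℝ))⁻¹ := by
    push_cast
    rw [mul_inv, inv_inv]
    gcongr
    linarith
  have hsum : (fun ω => ‖Matrix.toEuclideanLin (Φ ω) u‖ ^ 2) =
      ∑ i, fun ω => (∑ j, Φ ω i j * u j) ^ 2 := by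
    ext ω
    rw [EuclideanSpace.norm_sq_eq, Finset.sum_apply]
    simp [Matrix.mulVec, dotProduct]
  have hind : iIndepFun (fun (i : Fin n) ω => (∑ j, Φ ω i j * u j) ^ 2) P :=
    (hΦ.iIndepFun_rows u).comp (fun _ x => x ^ 2) fun _ => by fun_prop
  have hL := fun i => hΦ.hasLaw_rows hu i
  have hmeas : ∀ i, AEMeasurable (fun ω => (∑ j, Φ ω i j * u j) ^ 2) P := fun i =>
    (hL i).aemeasurable.pow_const 2
  have hint : ∀ i, Integrable (fun ω => Real.exp (s * n * (∑ j, Φ ω i j * u j) ^ 2)) P := fun i => by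
    have h := integrable_exp_mul_sq_gaussianReal hv ht
    rw [← (hL i).map_eq] at h
    exact h.comp_aemeasurable (hL i).aemeasurable
  have hmgf : ∀ i, mgf (fun ω => (∑ j, Φ ω i j * u j) ^ 2) P (s * n) = (√(1 - 2 * s))⁻¹ := fun i => by
    have h := integral_exp_mul_sq_gaussianReal hv ht
    rw [← (hL i).map_eq, integral_map (hL i).aemeasurable (by fun_prop)] at h
    rw [mgf, h]
    congr 3
    push_cast
    field_simp
  rw [hsum]
  constructor
  · have hmgf_pos : mgf (∑ i, fun ω => (∑ j, Φ ω i j * u j) ^ 2) P (s * n) ≠ 0 := by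
      rw [hind.mgf_sum₀ hmeas]
      simp_rw [hmgf]
      have : 0 < 1 - 2 * s := by linarith
      exact Finset.prod_ne_zero_iff.2 fun _ _ => by positivity
    by_contra hc
    apply hmgf_pos
    rw [mgf]
    refine integral_undef ?_
    convert hc using 5 with ω
    exact (congrFun hsum ω).symm
  · rw [hind.mgf_sum₀ hmeas]
    simp [hmgf]

end RowVariables

/-! ### Concentration of `‖Φ u‖²`. -/

theorem exists_chernoff_rates {η : ℝ} (hη : 0 < η) (hη1 : η < 1) :
    ∃ s ρ : ℝ, 0 < s ∧ s < 1 / 2 ∧ 0 ≤ ρ ∧ ρ < 1 ∧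
      Real.exp (-(s * (1 + η))) * (√(1 - 2 * s))⁻¹ ≤ ρ ∧
      Real.exp (s * (1 - η)) * (√(1 + 2 * s))⁻¹ ≤ ρ := by
  -- With `exp x ≥ 1 + x`, the two rates need `2s(1 + η) < η` and `2s(1 - η) < η`.
  set s := η / 8 with hs
  have key1 : Real.exp (-(s * (1 + η))) * (√(1 - 2 * s))⁻¹ < 1 := by
    have h1 : Real.exp (-(2 * s * (1 + η))) < 1 - 2 * s := by
      rw [Real.exp_neg, inv_lt_comm₀ (Real.exp_pos _) (by linarith)]
      refine lt_of_lt_of_le ?_ (Real.add_one_le_exp _)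
      rw [inv_lt_iff_one_lt_mul₀ (by linarith)]
      rw [hs]
      nlinarith [mul_pos hη hη, mul_pos (mul_pos hη hη) (sub_pos.2 hη1)]
    have h2 : Real.exp (-(s * (1 + η))) < √(1 - 2 * s) := by
      refine Real.lt_sqrt_of_sq_lt ?_
      rw [← Real.exp_nat_mul]
      convert h1 using 2
      push_cast; ring
    rw [← div_eq_mul_inv, div_lt_one (lt_trans (Real.exp_pos _) h2)]
    exact h2
  have key2 : Real.exp (s * (1 - η)) * (√(1 + 2 * s))⁻¹ < 1 := by
    have h1 : Real.exp (2 * s * (1 - η)) < 1 + 2 * s := by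
      rw [← inv_inv (Real.exp _), ← Real.exp_neg, inv_lt_comm₀ (Real.exp_pos _) (by linarith)]
      refine lt_of_lt_of_le ?_ (Real.add_one_le_exp _)
      rw [inv_lt_iff_one_lt_mul₀ (by linarith)]
      rw [hs]
      nlinarith [mul_pos hη hη, mul_pos (mul_pos hη hη) hη]
    have h2 : Real.exp (s * (1 - η)) < √(1 + 2 * s) := by
      refine Real.lt_sqrt_of_sq_lt ?_
      rw [← Real.exp_nat_mul]
      convert h1 using 2
      push_cast; ring
    rw [← div_eq_mul_inv, div_lt_one (lt_trans (Real.exp_pos _) h2)]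
    exact h2
  refine ⟨s, max _ _, by linarith, by linarith, le_trans (by positivity) (le_max_left _ _),
    max_lt key1 key2, le_max_left _ _, le_max_right _ _⟩

theorem exists_norm_sq_tail_bound {η : ℝ} (hη : 0 < η) (hη1 : η < 1) :
    ∃ ρ : ℝ, 0 ≤ ρ ∧ ρ < 1 ∧ ∀ (n N : ℕ), n ≠ 0 → ∀ (Ω : Type*) [MeasurableSpace Ω]
      (P : Measure Ω) [IsProbabilityMeasure P] (Φ : Ω → Matrix (Fin n) (Fin N) ℝ),
      IsGaussianRandomMatrix Φ P → ∀ u : EuclideanSpace ℝ (Fin N), ‖u‖ = 1 →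
      P.real {ω | η ≤ |‖Matrix.toEuclideanLin (Φ ω) u‖ ^ 2 - 1|} ≤ 2 * ρ ^ n := by
  obtain ⟨s, ρ, hs0, hs, hρ0, hρ1, h1, h2⟩ := exists_chernoff_rates hη hη1
  refine ⟨ρ, hρ0, hρ1, fun n N hn Ω _ P _ Φ hΦ u hu => ?_⟩
  obtain ⟨i1, m1⟩ := hΦ.mgf_norm_sq hn hu hs
  obtain ⟨i2, m2⟩ := hΦ.mgf_norm_sq hn hu (s := -s) (by linarith)
  have b1 := measure_ge_le_exp_mul_mgf (1 + η) (by positivity : 0 ≤ s * (n : ℝ)) i1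
  have b2 := measure_le_le_exp_mul_mgf (1 - η) (by nlinarith [Nat.cast_nonneg (α := ℝ) n] : -s * (n : ℝ) ≤ 0) i2
  rw [m1] at b1
  rw [m2] at b2
  have e1 : Real.exp (-(s * n) * (1 + η)) * (√(1 - 2 * s))⁻¹ ^ n ≤ ρ ^ n := by
    rw [show -(s * n) * (1 + η) = n * (-(s * (1 + η))) by ring, Real.exp_nat_mul, ← mul_pow]
    gcongr
  have e2 : Real.exp (-(-s * n) * (1 - η)) * (√(1 - 2 * -s))⁻¹ ^ n ≤ ρ ^ n := by
    rw [show -(-s * n) * (1 - η) = n * (s * (1 - η)) by ring, Real.exp_nat_mul, ← mul_pow,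
      show 1 - 2 * -s = 1 + 2 * s by ring]
    gcongr
  calc _ ≤ P.real ({ω | 1 + η ≤ ‖Matrix.toEuclideanLin (Φ ω) u‖ ^ 2} ∪
        {ω | ‖Matrix.toEuclideanLin (Φ ω) u‖ ^ 2 ≤ 1 - η}) := by
        refine measureReal_mono fun ω hω => ?_
        rcases le_abs.1 hω.out with h | h
        · exact Or.inl (Set.mem_ofPred_eq ▸ by linarith)
        · exact Or.inr (Set.mem_ofPred_eq ▸ by linarith)
    _ ≤ _ := measureReal_union_le _ _
    _ ≤ 2 * ρ ^ n := by linarith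

/-! ### From basis vectors to the whole subspace. -/

section NearIsometry

variable {E F : Type*} [NormedAddCommGroup E] [InnerProductSpace ℝ E]
  [NormedAddCommGroup F] [InnerProductSpace ℝ F]

/-- Polarization; the parallelogram law adds up the two errors. -/
theorem abs_inner_map_sub_inner_le (T : E →ₗ[ℝ] F) {η : ℝ} {x y : E}
    (hp : |‖T (x + y)‖ ^ 2 - ‖x + y‖ ^ 2| ≤ η * ‖x + y‖ ^ 2)
    (hm : |‖T (x - y)‖ ^ 2 - ‖x - y‖ ^ 2| ≤ η * ‖x - y‖ ^ 2) :
    |inner ℝ (T x) (T y) - inner ℝ x y| ≤ η * ((‖x‖ ^ 2 + ‖y‖ ^ 2) / 2) := by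
  rw [map_add, norm_add_sq_real, norm_add_sq_real, abs_le] at hp
  rw [map_sub, norm_sub_sq_real, norm_sub_sq_real, abs_le] at hm
  rw [abs_le]
  constructor <;> linarith [hp.1, hp.2, hm.1, hm.2]

/-- A linear map that almost preserves the norms of all sums and differences of the vectors of an
orthonormal basis is a near-isometry. -/
theorem near_isometry_of_basis {ι : Type*} [Fintype ι] (T : E →ₗ[ℝ] F) {W : Submodule ℝ E}
    (b : OrthonormalBasis ι ℝ W) {η : ℝ}
    (hp : ∀ i j, |‖T (b i + b j)‖ ^ 2 - ‖(b i + b j : E)‖ ^ 2| ≤ η * ‖(b i + b j : E)‖ ^ 2)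
    (hm : ∀ i j, |‖T (b i - b j)‖ ^ 2 - ‖(b i - b j : E)‖ ^ 2| ≤ η * ‖(b i - b j : E)‖ ^ 2) :
    ∀ w ∈ W, |‖T w‖ ^ 2 - ‖w‖ ^ 2| ≤ η * Fintype.card ι * ‖w‖ ^ 2 := by
  intro w hw
  have hG : ∀ i j, |inner ℝ (T (b i)) (T (b j)) - inner ℝ (b i : E) (b j)| ≤ η := fun i j => by
    have hn : ∀ i, ‖(b i : E)‖ = 1 := fun i => b.norm_eq_one i
    simpa [hn] using abs_inner_map_sub_inner_le T (hp i j) (hm i j)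
  set c : ι → ℝ := fun i => b.repr ⟨w, hw⟩ i with hc
  have hw' : w = ∑ i, c i • (b i : E) := by
    have := congrArg Subtype.val (b.sum_repr ⟨w, hw⟩)
    simpa using this.symm
  have hnorm : ∑ i, c i ^ 2 = ‖w‖ ^ 2 := by
    have h1 := b.repr.norm_map ⟨w, hw⟩
    change _ = ‖w‖ at h1
    rw [← h1, EuclideanSpace.norm_sq_eq]
    simp [hc]
  -- A quadratic form in the coordinates, with coefficients at most `η` in absolute value.
  -- Cauchy-Schwarz then costs the factor `card ι`.
  have hexp : ‖T w‖ ^ 2 - ‖w‖ ^ 2 =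
      ∑ i, ∑ j, c i * c j * (inner ℝ (T (b i)) (T (b j)) - inner ℝ (b i : E) (b j)) := by
    rw [← real_inner_self_eq_norm_sq, ← real_inner_self_eq_norm_sq, hw', map_sum]
    simp_rw [map_smul, sum_inner, inner_sum, real_inner_smul_left, real_inner_smul_right]
    rw [← Finset.sum_sub_distrib]
    refine Finset.sum_congr rfl fun i _ => ?_
    rw [← Finset.sum_sub_distrib]
    exact Finset.sum_congr rfl fun j _ => by ring
  rcases isEmpty_or_nonempty ι with hι | ⟨⟨i₀⟩⟩
  · rw [hexp]; simp
  have hη : 0 ≤ η := (abs_nonneg _).trans (hG i₀ i₀)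
  calc |‖T w‖ ^ 2 - ‖w‖ ^ 2| ≤ ∑ i, ∑ j, |c i| * |c j| * η := by
        rw [hexp]
        refine (Finset.abs_sum_le_sum_abs _ _).trans (Finset.sum_le_sum fun i _ => ?_)
        refine (Finset.abs_sum_le_sum_abs _ _).trans (Finset.sum_le_sum fun j _ => ?_)
        rw [abs_mul, abs_mul]
        exact mul_le_mul_of_nonneg_left (hG i j) (by positivity)
    _ = η * (∑ i, |c i|) ^ 2 := by
        simp_rw [sq, Finset.sum_mul_sum, Finset.mul_sum]
        exact Finset.sum_congr rfl fun i _ => Finset.sum_congr rfl fun j _ => by ring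
    _ ≤ η * (Fintype.card ι * ∑ i, |c i| ^ 2) := by
        gcongr
        exact sq_sum_le_card_mul_sum_sq
    _ = _ := by
        simp_rw [sq_abs]
        rw [hnorm]
        ring

end NearIsometry

/-- A union bound over the sums and differences of basis pairs; `ρ` depends on `η` alone, which
keeps the threshold for `n` uniform in `N` and `W`. -/
theorem exists_near_isometry_tail_bound {η : ℝ} (hη : 0 < η) (hη1 : η < 1) :
    ∃ ρ : ℝ, 0 ≤ ρ ∧ ρ < 1 ∧ ∀ (n N : ℕ), n ≠ 0 → ∀ (Ω : Type*) [MeasurableSpace Ω]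
      (P : Measure Ω) [IsProbabilityMeasure P] (Φ : Ω → Matrix (Fin n) (Fin N) ℝ),
      IsGaussianRandomMatrix Φ P → ∀ W : Submodule ℝ (EuclideanSpace ℝ (Fin N)),
      P.real {ω | ¬ ∀ w ∈ W, |‖Matrix.toEuclideanLin (Φ ω) w‖ ^ 2 - ‖w‖ ^ 2| ≤
        η * Module.finrank ℝ W * ‖w‖ ^ 2} ≤ 4 * (Module.finrank ℝ W : ℝ) ^ 2 * ρ ^ n := by
  obtain ⟨ρ, hρ0, hρ1, hρ⟩ := exists_norm_sq_tail_bound hη hη1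
  refine ⟨ρ, hρ0, hρ1, fun n N hn Ω _ P _ Φ hΦ W => ?_⟩
  let bad (v : EuclideanSpace ℝ (Fin N)) : Set Ω :=
    {ω | ¬ |‖Matrix.toEuclideanLin (Φ ω) v‖ ^ 2 - ‖v‖ ^ 2| ≤ η * ‖v‖ ^ 2}
  have hbad : ∀ v, P.real (bad v) ≤ 2 * ρ ^ n := by
    intro v
    rcases eq_or_ne v 0 with rfl | hv
    · have : bad 0 = ∅ := by ext; simp [bad]
      rw [this, measureReal_empty]
      positivity
    have hv0 : 0 < ‖v‖ := norm_pos_iff.2 hv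
    refine le_trans (measureReal_mono fun ω hω => ?_)
      (hρ n N hn Ω P Φ hΦ (‖v‖⁻¹ • v) (norm_smul_inv_norm hv))
    have h1 : η * ‖v‖ ^ 2 < |‖Matrix.toEuclideanLin (Φ ω) v‖ ^ 2 - ‖v‖ ^ 2| := not_le.1 hω
    have h2 : ‖Matrix.toEuclideanLin (Φ ω) (‖v‖⁻¹ • v)‖ ^ 2 - 1 =
        (‖Matrix.toEuclideanLin (Φ ω) v‖ ^ 2 - ‖v‖ ^ 2) / ‖v‖ ^ 2 := by
      rw [map_smul, norm_smul, norm_inv, norm_norm]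
      field_simp
    rw [Set.mem_ofPred_eq, h2, abs_div, abs_of_pos (by positivity : 0 < ‖v‖ ^ 2),
      le_div_iff₀ (by positivity)]
    exact h1.le
  let b := stdOrthonormalBasis ℝ W
  let d := Module.finrank ℝ W
  have hsub : {ω | ¬ ∀ w ∈ W, |‖Matrix.toEuclideanLin (Φ ω) w‖ ^ 2 - ‖w‖ ^ 2| ≤
      η * Module.finrank ℝ W * ‖w‖ ^ 2} ⊆
      ⋃ p : Fin d × Fin d, (bad (b p.1 + b p.2) ∪ bad (b p.1 - b p.2)) := by
    intro ω hω
    by_contra hc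
    simp only [Set.mem_iUnion, Set.mem_union, not_exists, not_or, Prod.forall] at hc
    apply hω
    have := near_isometry_of_basis (Matrix.toEuclideanLin (Φ ω)) b (η := η)
      (fun i j => not_not.1 (hc i j).1) (fun i j => not_not.1 (hc i j).2)
    simpa using this
  calc _ ≤ _ := measureReal_mono hsub
    _ ≤ ∑ p : Fin d × Fin d, P.real (bad (b p.1 + b p.2) ∪ bad (b p.1 - b p.2)) :=
      measureReal_iUnion_fintype_le _
    _ ≤ ∑ p : Fin d × Fin d, (2 * ρ ^ n + 2 * ρ ^ n) :=
      Finset.sum_le_sum fun p _ => (measureReal_union_le _ _).trans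
        (add_le_add (hbad _) (hbad _))
    _ = _ := by
      simp only [Finset.sum_const, Finset.card_univ, Fintype.card_prod, Fintype.card_fin,
        nsmul_eq_mul, d]
      push_cast
      ring

/-- A near-isometry of `X₁ + X₂` with distortion `ε / (2 + ε)` changes the squared distance of
`X₁` and `X₂` by a factor between `1 - ε` and `1 + ε`. -/
theorem projFDist_sq_map_bounds {n N : ℕ} (A : Matrix (Fin n) (Fin N) ℝ)
    {X₁ X₂ : Submodule ℝ (EuclideanSpace ℝ (Fin N))}
    (hd : Module.finrank ℝ X₁ ≤ Module.finrank ℝ X₂) {ε : ℝ} (hε : 0 < ε)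
    (h : ∀ w ∈ X₁ ⊔ X₂, |‖Matrix.toEuclideanLin A w‖ ^ 2 - ‖w‖ ^ 2| ≤ ε / (2 + ε) * ‖w‖ ^ 2) :
    (1 - ε) * projFDist X₁ X₂ ^ 2 ≤
        projFDist (projectSubspace A X₁) (projectSubspace A X₂) ^ 2 ∧
      projFDist (projectSubspace A X₁) (projectSubspace A X₂) ^ 2 ≤
        (1 + ε) * projFDist X₁ X₂ ^ 2 := by
  -- With `δ = ε / (2 + ε)`, the quotient `(1 + δ) / (1 - δ)` is exactly `1 + ε`.
  have hpos : 0 < 2 / (2 + ε) := by positivity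
  have hδ : ε / (2 + ε) = 1 - 2 / (2 + ε) := by field_simp; ring
  have hδ' : 1 + ε / (2 + ε) = (1 + ε) * (2 / (2 + ε)) := by field_simp; ring
  have hl : ∀ w ∈ X₁ ⊔ X₂, 2 / (2 + ε) * ‖w‖ ^ 2 ≤ ‖Matrix.toEuclideanLin A w‖ ^ 2 :=
    fun w hw => by
      have := (abs_le.1 (h w hw)).1
      rw [hδ] at this
      linarith
  have hu : ∀ w ∈ X₁ ⊔ X₂,
      ‖Matrix.toEuclideanLin A w‖ ^ 2 ≤ (1 + ε) * (2 / (2 + ε)) * ‖w‖ ^ 2 := fun w hw => by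
    have := (abs_le.1 (h w hw)).2
    rw [← hδ']
    linarith
  have hinj := injOn_of_lower_bound hpos hl
  have hf₁ := finrank_map_of_injOn fun w hw => hinj w (le_sup_left (a := X₁) (b := X₂) hw)
  have hf₂ := finrank_map_of_injOn fun w hw => hinj w (le_sup_right (a := X₁) (b := X₂) hw)
  obtain ⟨h1, h2⟩ := projDefect_map_bounds hpos (by positivity) hl hu
  rw [mul_inv_cancel_right₀ hpos.ne'] at h1
  rw [mul_comm _ ((1 + ε) * _), mul_inv_cancel_right₀ hpos.ne'] at h2
  have hn := projDefect_nonneg X₁ X₂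
  have hn' := projDefect_nonneg (X₁.map (Matrix.toEuclideanLin A)) (X₂.map (Matrix.toEuclideanLin A))
  have hd' : (Module.finrank ℝ X₁ : ℝ) ≤ Module.finrank ℝ X₂ := by exact_mod_cast hd
  rw [projFDist_sq, projFDist_sq, projectSubspace, projectSubspace, hf₁, hf₂]
  set s := projDefect X₁ X₂
  set s' := projDefect (X₁.map (Matrix.toEuclideanLin A)) (X₂.map (Matrix.toEuclideanLin A))
  -- The dimension term is unchanged by the map; being nonnegative, it respects both factors.
  have hsub : 0 ≤ ε * ((Module.finrank ℝ X₂ : ℝ) - Module.finrank ℝ X₁) :=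
    mul_nonneg hε.le (sub_nonneg.2 hd')
  constructor
  · have : (1 - ε) * s ≤ s' := by
      rcases le_total 1 ε with h | h
      · nlinarith
      · nlinarith [mul_le_mul_of_nonneg_left h2 (sub_nonneg.2 h), mul_nonneg (sq_nonneg ε) hn']
    linarith
  · linarith

/-! ### The main theorem. -/

theorem projDefect_eq_zero_of_finrank_eq_zero {E : Type*} [NormedAddCommGroup E]
    [InnerProductSpace ℝ E] [FiniteDimensional ℝ E] {X Y : Submodule ℝ E}
    (h : Module.finrank ℝ X = 0) : projDefect X Y = 0 := by
  obtain rfl := Submodule.finrank_eq_zero.1 h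
  refine Finset.sum_eq_zero fun i _ => ?_
  have h0 := (Submodule.mem_bot ℝ).1 (stdOrthonormalBasis ℝ (⊥ : Submodule ℝ E) i).2
  simp [h0]

theorem theorem3 (d₁ d₂ : ℕ) (hd : d₁ ≤ d₂) (ε : ℝ) (hε : 0 < ε) :
    ∃ n₀ : ℕ, ∀ n : ℕ, n₀ ≤ n → ∀ N : ℕ,
      ∀ X₁ X₂ : Submodule ℝ (EuclideanSpace ℝ (Fin N)),
      Module.finrank ℝ X₁ = d₁ → Module.finrank ℝ X₂ = d₂ →
      ∀ (Ω : Type*) [MeasurableSpace Ω] (P : Measure Ω) [IsProbabilityMeasure P]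
        (Φ : Ω → Matrix (Fin n) (Fin N) ℝ), IsGaussianRandomMatrix Φ P →
      1 - 4 * (d₁ : ℝ) / ((ε - (d₂ : ℝ) / (n : ℝ)) ^ 2 * (n : ℝ)) ≤
        P.real {ω |
          (1 - ε) * projFDist X₁ X₂ ^ 2 ≤
              projFDist (projectSubspace (Φ ω) X₁) (projectSubspace (Φ ω) X₂) ^ 2 ∧
            projFDist (projectSubspace (Φ ω) X₁) (projectSubspace (Φ ω) X₂) ^ 2 ≤
              (1 + ε) * projFDist X₁ X₂ ^ 2} := by
  rcases Nat.eq_zero_or_pos d₁ with rfl | hd₁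
  · refine ⟨max d₂ 1, fun n hn N X₁ X₂ h₁ h₂ Ω _ P _ Φ hΦ => ?_⟩
    have hn0 : n ≠ 0 := by have := le_of_max_le_right hn; omega
    have hae := hΦ.ae_injOn X₂ (h₂ ▸ le_of_max_le_left hn) hn0
    have hfull : ∀ᵐ ω ∂P, ω ∈ {ω |
          (1 - ε) * projFDist X₁ X₂ ^ 2 ≤
              projFDist (projectSubspace (Φ ω) X₁) (projectSubspace (Φ ω) X₂) ^ 2 ∧
            projFDist (projectSubspace (Φ ω) X₁) (projectSubspace (Φ ω) X₂) ^ 2 ≤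
              (1 + ε) * projFDist X₁ X₂ ^ 2} := by
      filter_upwards [hae] with ω hω
      have hf₂ := finrank_map_of_injOn hω
      have hf₁ : Module.finrank ℝ (X₁.map (Matrix.toEuclideanLin (Φ ω))) = 0 :=
        Nat.le_zero.1 ((Submodule.finrank_map_le _ _).trans h₁.le)
      have heq : projFDist (projectSubspace (Φ ω) X₁) (projectSubspace (Φ ω) X₂) ^ 2 =
          projFDist X₁ X₂ ^ 2 := by
        rw [projFDist_sq, projFDist_sq, projectSubspace, projectSubspace, hf₁, hf₂, h₁,
          projDefect_eq_zero_of_finrank_eq_zero hf₁, projDefect_eq_zero_of_finrank_eq_zero h₁]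
      rw [heq]
      constructor <;> nlinarith [mul_nonneg hε.le (sq_nonneg (projFDist X₁ X₂))]
    have h1 : P.real _ = P.real Set.univ := measureReal_congr (Filter.eventuallyEq_univ.2 hfull)
    refine le_of_le_of_eq ?_ (h1.trans probReal_univ).symm
    simp
  · set D : ℝ := d₁ + d₂ with hD
    -- The near-isometry bound loses a factor `dim (X₁ + X₂) ≤ D`.
    set η : ℝ := ε / (2 + ε) / (D + 1) with hη
    have hD0 : 0 < D := by positivity
    have hδ1 : ε / (2 + ε) < 1 := by rw [div_lt_one (by positivity)]; linarith
    have hη0 : 0 < η := by positivity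
    have hη1 : η < 1 := by
      rw [hη, div_lt_one (by positivity)]
      linarith
    have hηD : η * D ≤ ε / (2 + ε) := by
      rw [hη, div_mul_eq_mul_div, div_le_iff₀ (by positivity)]
      gcongr
      linarith
    obtain ⟨ρ, hρ0, hρ1, hρ⟩ := exists_near_isometry_tail_bound hη0 hη1
    -- `n₀` ensures `ε² D² n ρ ^ n ≤ 1` and `d₂ / n < ε`, so that `0 < ε - d₂ / n ≤ ε` and the gap
    -- may be replaced by `ε`.
    have hlim := (tendsto_self_mul_const_pow_of_lt_one hρ0 hρ1).const_mul (ε ^ 2 * D ^ 2)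
    rw [mul_zero] at hlim
    have hev := (hlim.eventually_le_const one_pos).and
      ((Filter.eventually_gt_atTop 0).and
        (tendsto_natCast_atTop_atTop.eventually_gt_atTop ((d₂ : ℝ) / ε)))
    obtain ⟨n₀, hn₀⟩ := Filter.eventually_atTop.1 hev
    refine ⟨n₀, fun n hn N X₁ X₂ h₁ h₂ Ω _ P _ Φ hΦ => ?_⟩
    obtain ⟨hsmall, hn0, hnε⟩ := hn₀ n hn
    have hn0' : (0 : ℝ) < n := by exact_mod_cast hn0
    have hgap : 0 < ε - (d₂ : ℝ) / n := by
      rw [sub_pos, div_lt_iff₀ hn0', mul_comm]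
      rwa [div_lt_iff₀ hε] at hnε
    have hgap' : ε - (d₂ : ℝ) / n ≤ ε := sub_le_self _ (by positivity)
    set W := X₁ ⊔ X₂
    have hW : (Module.finrank ℝ W : ℝ) ≤ D := by
      have := Submodule.finrank_add_le_finrank_add_finrank X₁ X₂
      rw [h₁, h₂] at this
      rw [hD]
      exact_mod_cast this
    have hbad := hρ n N hn0.ne' Ω P Φ hΦ W
    have hcover := measureReal_mono (μ := P) (s₁ := Set.univ)
      (s₂ := {ω | (1 - ε) * projFDist X₁ X₂ ^ 2 ≤
              projFDist (projectSubspace (Φ ω) X₁) (projectSubspace (Φ ω) X₂) ^ 2 ∧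
            projFDist (projectSubspace (Φ ω) X₁) (projectSubspace (Φ ω) X₂) ^ 2 ≤
              (1 + ε) * projFDist X₁ X₂ ^ 2} ∪
        {ω | ¬ ∀ w ∈ W, |‖Matrix.toEuclideanLin (Φ ω) w‖ ^ 2 - ‖w‖ ^ 2| ≤
          η * Module.finrank ℝ W * ‖w‖ ^ 2}) fun ω _ => by
        by_cases hω : ∀ w ∈ W, |‖Matrix.toEuclideanLin (Φ ω) w‖ ^ 2 - ‖w‖ ^ 2| ≤
          η * Module.finrank ℝ W * ‖w‖ ^ 2
        · refine Or.inl (projFDist_sq_map_bounds (Φ ω) (by rw [h₁, h₂]; exact hd) hε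
            fun w hw => (hω w hw).trans ?_)
          gcongr
          exact le_trans (by gcongr) hηD
        · exact Or.inr hω
    have hunion := hcover.trans (measureReal_union_le _ _)
    rw [probReal_univ] at hunion
    have hfinal : 4 * (Module.finrank ℝ W : ℝ) ^ 2 * ρ ^ n ≤
        4 * (d₁ : ℝ) / ((ε - (d₂ : ℝ) / (n : ℝ)) ^ 2 * (n : ℝ)) := by
      have hd₁' : (1 : ℝ) ≤ d₁ := by exact_mod_cast hd₁
      rw [le_div_iff₀ (by positivity)]
      calc 4 * (Module.finrank ℝ W : ℝ) ^ 2 * ρ ^ n * ((ε - (d₂ : ℝ) / (n : ℝ)) ^ 2 * (n : ℝ))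
          ≤ 4 * D ^ 2 * ρ ^ n * (ε ^ 2 * n) := by gcongr
        _ = 4 * (ε ^ 2 * D ^ 2 * (n * ρ ^ n)) := by ring
        _ ≤ 4 * 1 := by gcongr
        _ ≤ 4 * (d₁ : ℝ) := by gcongr
    linarith
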